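/- Let $\ell>0$, let $H$ be an entire function, and put $\nu(z)=e^{\ell(z+z^{-1})/2}H(z)$ for $z\neq 0$. Assume that $d\mu(z)=\frac{\nu(z)}{iz}\,dz$ is a nontrivial positive measure on the unit circle $\mathbb T$, i.e. $\nu$ is real and nonnegative on $\mathbb T$ and not identically zero there. Let $\Phi_n$ ($n\ge 0$) be the monic orthogonal polynomials of $\mu$, $\deg\Phi_n=n$, $$\int_{\mathbb T}\Phi_n(z)\overline{\Phi_m(z)}\,\frac{\nu(z)}{iz}\,dz=\kappa_n^{-2}\delta_{n,m},\qquad \kappa_n>0,$$ and put $\Phi_n^*(z)=z^n\overline{\Phi_n(1/\bar z)}$, $\alpha_{n-1}=-\overline{\Phi_n(0)}$ for $n\ge 1$, $b_n=2\pi\kappa_n^2$, $$G_n(z)=\frac1{2\pi i}\int_{\mathbb T}\frac{\Phi_n(t)}{t-z}\frac{\nu(t)}{t^n}\,dt,\qquad G^*_{n-1}(z)=\frac1{2\pi i}\int_{\mathbb T}\frac{\Phi^*_{n-1}(t)}{t-z}\frac{\nu(t)}{t^n}\,dt .$$ For $n\ge1$ and $z\notin\mathbb T$ let $$Y_n(z)=\begin{bmatrix}\Phi_n(z)&G_n(z)\\-b_{n-1}\Phi^*_{n-1}(z)&-b_{n-1}G^*_{n-1}(z)\end{bmatrix},$$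 and for $z\notin\mathbb T\cup\{0\}$ let $$Z_n(z)=Y_n(z)\begin{bmatrix}z^{-n/2}\nu(z)^{1/2}&0\\0&z^{n/2}\nu(z)^{-1/2}\end{bmatrix},\qquad M_n(z)=Z_n'(z)Z_n(z)^{-1},$$ where near each point of $\mathbb C\setminus(\mathbb T\cup\{0\})$ holomorphic branches of $z^{1/2}$ and $\nu^{1/2}$ exist, and $M_n$ does not depend on their choice. Then, for every $n\ge 1$, $M_n$ extends to a holomorphic matrix function in $\mathbb C\setminus\{0\}$ which has a pole of order exactly $2$ at $z=0$, and $$\lim_{z\to0}z^2M_n(z)=\begin{bmatrix}\frac{\ell}{4}\left(b_{n-1}b_n^{-1}-\alpha_{n-1}^2\right)&-\frac{\ell}{2}b_n^{-1}\alpha_{n-1}\\-\frac{\ell}{2}b_{n-1}\alpha_{n-1}&-\frac{\ell}{4}\left(b_{n-1}b_n^{-1}-\alpha_{n-1}^2\right)\end{bmatrix}\neq 0 .$$ -/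

import Mathlib

open Polynomial Filter Topology

namespace OPUC

/-- `ν` is the density of a nontrivial positive measure `ν(z) dz / (i z)` on the unit circle. -/
structure IsPositiveWeight (ν : ℂ → ℂ) : Prop where
  continuousOn : ContinuousOn ν (Metric.sphere 0 1)
  real : ∀ z ∈ Metric.sphere (0 : ℂ) 1, (ν z).im = 0
  nonneg : ∀ z ∈ Metric.sphere (0 : ℂ) 1, 0 ≤ (ν z).re
  nontrivial : ∃ z ∈ Metric.sphere (0 : ℂ) 1, ν z ≠ 0

/-- `∫_𝕋 p(z) conj(q(z)) ν(z) / (i z) dz`. -/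
noncomputable def pairing (ν : ℂ → ℂ) (p q : ℂ[X]) : ℂ :=
  ∮ z in C(0, 1), p.eval z * (starRingEnd ℂ) (q.eval z) * (ν z / (Complex.I * z))

/-- The monic orthogonal polynomials `Φ_n` of the weight `ν`, by Gram–Schmidt applied to
`1, z, z², …`; the characterizing properties are `monicOP_monic`, `monicOP_natDegree` and
`pairing_monicOP`. -/
noncomputable def monicOP (ν : ℂ → ℂ) (n : ℕ) : ℂ[X] :=
  X ^ n - ∑ k : Fin n, C (pairing ν (X ^ n) (monicOP ν k) /
    pairing ν (monicOP ν k) (monicOP ν k)) * monicOP ν k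
termination_by n
decreasing_by all_goals exact k.2

/-- `κ_n > 0` with `κ_n⁻² = ∫_𝕋 |Φ_n|² dμ`. -/
noncomputable def kappa (ν : ℂ → ℂ) (n : ℕ) : ℝ :=
  (Real.sqrt (pairing ν (monicOP ν n) (monicOP ν n)).re)⁻¹

/-- `b_n = 2 π κ_n²`. -/
noncomputable def b (ν : ℂ → ℂ) (n : ℕ) : ℝ := 2 * Real.pi * kappa ν n ^ 2

theorem monicOP_eq (ν : ℂ → ℂ) (n : ℕ) :
    monicOP ν n = X ^ n - ∑ k : Fin n, C (pairing ν (X ^ n) (monicOP ν k) /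
      pairing ν (monicOP ν k) (monicOP ν k)) * monicOP ν k := by
  rw [monicOP]

theorem monicOP_aux (ν : ℂ → ℂ) (n : ℕ) :
    (monicOP ν n).Monic ∧ (monicOP ν n).natDegree = n := by
  induction n using Nat.strong_induction_on with
  | _ n ih =>
    have hd : (∑ k : Fin n, C (pairing ν (X ^ n) (monicOP ν k) /
        pairing ν (monicOP ν k) (monicOP ν k)) * monicOP ν k).degree < (n : WithBot ℕ) := by
      refine lt_of_le_of_lt (degree_sum_le _ _) ?_
      refine (Finset.sup_lt_iff (WithBot.bot_lt_coe n)).2 fun k _ => ?_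
      refine lt_of_le_of_lt degree_le_natDegree ?_
      refine lt_of_le_of_lt (WithBot.coe_le_coe.2 (natDegree_C_mul_le _ _)) ?_
      rw [(ih k k.2).2]
      exact_mod_cast k.2
    have hm : (monicOP ν n).Monic := by
      rw [monicOP_eq]
      exact monic_X_pow_sub hd
    refine ⟨hm, ?_⟩
    rw [monicOP_eq, sub_eq_add_neg]
    refine natDegree_eq_of_degree_eq_some ?_
    rw [degree_add_eq_left_of_degree_lt, degree_X_pow]
    rwa [degree_neg, degree_X_pow]

theorem monicOP_monic (ν : ℂ → ℂ) (n : ℕ) : (monicOP ν n).Monic := (monicOP_aux ν n).1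

theorem monicOP_natDegree (ν : ℂ → ℂ) (n : ℕ) : (monicOP ν n).natDegree = n :=
  (monicOP_aux ν n).2

theorem pairing_eq (ν : ℂ → ℂ) (p q : ℂ[X]) :
    pairing ν p q = ∫ θ in (0 : ℝ)..2 * Real.pi, p.eval (circleMap 0 1 θ) *
      (starRingEnd ℂ) (q.eval (circleMap 0 1 θ)) * ν (circleMap 0 1 θ) := by
  unfold pairing circleIntegral
  refine intervalIntegral.integral_congr fun θ _ => ?_
  have h : circleMap 0 1 θ ≠ 0 := circleMap_ne_center one_ne_zero
  simp only [deriv_circleMap, smul_eq_mul]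
  field_simp

theorem IsPositiveWeight.continuous_circle {ν : ℂ → ℂ} (hν : IsPositiveWeight ν) :
    Continuous fun θ : ℝ => ν (circleMap 0 1 θ) :=
  hν.continuousOn.comp_continuous (continuous_circleMap 0 1)
    (circleMap_mem_sphere 0 zero_le_one)

theorem continuous_pairing {ν : ℂ → ℂ} (hν : IsPositiveWeight ν) (p q : ℂ[X]) :
    Continuous fun θ : ℝ => p.eval (circleMap 0 1 θ) *
      (starRingEnd ℂ) (q.eval (circleMap 0 1 θ)) * ν (circleMap 0 1 θ) :=
  ((p.continuous.comp (continuous_circleMap 0 1)).mul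
    (Complex.continuous_conj.comp (q.continuous.comp (continuous_circleMap 0 1)))).mul
    hν.continuous_circle

theorem pairing_sub {ν : ℂ → ℂ} (hν : IsPositiveWeight ν) (p q r : ℂ[X]) :
    pairing ν (p - q) r = pairing ν p r - pairing ν q r := by
  rw [pairing_eq, pairing_eq, pairing_eq, ← intervalIntegral.integral_sub
    ((continuous_pairing hν p r).intervalIntegrable _ _)
    ((continuous_pairing hν q r).intervalIntegrable _ _)]
  congr 1; ext θ; simp; ring

theorem pairing_C_mul (ν : ℂ → ℂ) (c : ℂ) (p r : ℂ[X]) :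
    pairing ν (C c * p) r = c * pairing ν p r := by
  rw [pairing_eq, pairing_eq, ← intervalIntegral.integral_const_mul]
  congr 1; ext θ; simp; ring

theorem pairing_sum {ν : ℂ → ℂ} (hν : IsPositiveWeight ν) {ι : Type} (s : Finset ι)
    (f : ι → ℂ[X]) (r : ℂ[X]) :
    pairing ν (∑ k ∈ s, f k) r = ∑ k ∈ s, pairing ν (f k) r := by
  simp only [pairing_eq]
  rw [← intervalIntegral.integral_finsetSum
    fun k _ => (continuous_pairing hν (f k) r).intervalIntegrable _ _]
  congr 1; ext θ; simp [eval_finsetSum, Finset.sum_mul]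

theorem pairing_conj {ν : ℂ → ℂ} (hν : IsPositiveWeight ν) (p q : ℂ[X]) :
    (starRingEnd ℂ) (pairing ν p q) = pairing ν q p := by
  rw [pairing_eq, pairing_eq, ← intervalIntegral.intervalIntegral_conj]
  congr 1; ext θ
  have h : (starRingEnd ℂ) (ν (circleMap 0 1 θ)) = ν (circleMap 0 1 θ) :=
    Complex.conj_eq_iff_im.2 (hν.real _ (circleMap_mem_sphere 0 zero_le_one θ))
  simp only [map_mul, Complex.conj_conj, h]; ring

theorem pairing_self_eq {ν : ℂ → ℂ} (hν : IsPositiveWeight ν) (p : ℂ[X]) :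
    pairing ν p p = ((∫ θ in (0 : ℝ)..2 * Real.pi,
      Complex.normSq (p.eval (circleMap 0 1 θ)) * (ν (circleMap 0 1 θ)).re : ℝ) : ℂ) := by
  rw [pairing_eq, ← intervalIntegral.integral_ofReal]
  congr 1; ext θ
  have h : ν (circleMap 0 1 θ) = ((ν (circleMap 0 1 θ)).re : ℂ) :=
    Complex.ext rfl (hν.real _ (circleMap_mem_sphere 0 zero_le_one θ))
  rw [Complex.mul_conj, h]; simp

theorem pairing_self_pos {ν : ℂ → ℂ} (hν : IsPositiveWeight ν) {p : ℂ[X]} (hp : p ≠ 0) :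
    0 < (pairing ν p p).re := by
  rw [pairing_self_eq hν, Complex.ofReal_re]
  have hc : Continuous fun θ : ℝ =>
      Complex.normSq (p.eval (circleMap 0 1 θ)) * (ν (circleMap 0 1 θ)).re :=
    (Complex.continuous_normSq.comp (p.continuous.comp (continuous_circleMap 0 1))).mul
      (Complex.continuous_re.comp hν.continuous_circle)
  have hnn : ∀ θ : ℝ, 0 ≤ Complex.normSq (p.eval (circleMap 0 1 θ)) * (ν (circleMap 0 1 θ)).re :=
    fun θ => mul_nonneg (Complex.normSq_nonneg _)
      (hν.nonneg _ (circleMap_mem_sphere 0 zero_le_one θ))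
  refine intervalIntegral.integral_pos Real.two_pi_pos hc.continuousOn (fun θ _ => hnn θ) ?_
  by_contra! hcon
  obtain ⟨z, hz, hz0⟩ := hν.nontrivial
  obtain ⟨t, rfl⟩ : ∃ t : ℝ, circleMap 0 1 t = z := by
    have := range_circleMap (0 : ℂ) 1
    rw [abs_one] at this
    rw [← this] at hz
    exact hz
  have hU : IsOpen {θ : ℝ | ν (circleMap 0 1 θ) ≠ 0} :=
    isOpen_ne.preimage hν.continuous_circle
  obtain ⟨ε, hε, hball⟩ := Metric.isOpen_iff.1 hU t hz0
  have hroots : ∀ θ ∈ Metric.ball t ε, circleMap 0 1 θ ∈ (p.roots.toFinset : Set ℂ) := by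
    intro θ hθ
    have hνθ : ν (circleMap 0 1 θ) ≠ 0 := hball hθ
    obtain ⟨θ', hθ', hcm⟩ : ∃ θ' ∈ Set.Ico (0 : ℝ) (0 + 2 * Real.pi),
        circleMap 0 1 θ = circleMap 0 1 θ' :=
      Function.Periodic.exists_mem_Ico (periodic_circleMap 0 1) Real.two_pi_pos θ 0
    have h0 := le_antisymm (hcon θ' ⟨hθ'.1, by linarith [hθ'.2]⟩) (hnn θ')
    rw [← hcm] at h0
    have hre : (ν (circleMap 0 1 θ)).re ≠ 0 := fun h =>
      hνθ (Complex.ext h (hν.real _ (circleMap_mem_sphere 0 zero_le_one θ)))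
    have := (mul_eq_zero.1 h0).resolve_right hre
    simpa [hp] using this
  have hinj : Set.InjOn (circleMap 0 1) (Set.Ioo t (t + min ε Real.pi)) := by
    intro x hx y hy hxy
    have := Real.pi_pos
    have h1 := hx.2.trans_le (add_le_add_right (min_le_right ε Real.pi) t)
    have h2 := hy.2.trans_le (add_le_add_right (min_le_right ε Real.pi) t)
    refine injOn_circleMap_of_abs_sub_le' (c := 0) (R := 1) (a := t) (b := t + Real.pi) one_ne_zero
      (by linarith) ⟨hx.1.le, h1⟩ ⟨hy.1.le, h2⟩ hxy
  have hfin : (Set.Ioo t (t + min ε Real.pi)).Finite := by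
    refine Set.Finite.of_finite_image ((Finset.finite_toSet p.roots.toFinset).subset ?_) hinj
    rintro _ ⟨θ, hθ, rfl⟩
    refine hroots θ ?_
    rw [Metric.mem_ball, Real.dist_eq, abs_lt]
    have := min_le_left ε Real.pi
    constructor <;> linarith [hθ.1, hθ.2]
  exact (Set.Ioo_infinite (by linarith [lt_min hε Real.pi_pos])) hfin

theorem kappa_pos {ν : ℂ → ℂ} (hν : IsPositiveWeight ν) (n : ℕ) : 0 < kappa ν n :=
  inv_pos.2 (Real.sqrt_pos.2 (pairing_self_pos hν (monicOP_monic ν n).ne_zero))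

/-- The orthogonality relations `∫_𝕋 Φ_n conj(Φ_m) dμ = κ_n⁻² δ_{n,m}`. -/
theorem pairing_monicOP {ν : ℂ → ℂ} (hν : IsPositiveWeight ν) (n m : ℕ) :
    pairing ν (monicOP ν n) (monicOP ν m) = if n = m then (((kappa ν n) ^ 2)⁻¹ : ℂ) else 0 := by
  have hself : ∀ k, pairing ν (monicOP ν k) (monicOP ν k) ≠ 0 := fun k h => by
    have := pairing_self_pos hν (monicOP_monic ν k).ne_zero
    rw [h] at this
    simp at this
  have key : ∀ n, ∀ m < n, pairing ν (monicOP ν n) (monicOP ν m) = 0 := by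
    intro n
    induction n using Nat.strong_induction_on with
    | _ n ih =>
      intro m hm
      rw [monicOP_eq ν n, pairing_sub hν, pairing_sum hν, Finset.sum_eq_single ⟨m, hm⟩]
      · rw [pairing_C_mul, div_mul_cancel₀ _ (hself m), sub_self]
      · intro k _ hk
        rw [pairing_C_mul]
        have hkm : (k : ℕ) ≠ m := fun h => hk (Fin.ext h)
        rcases lt_or_gt_of_ne hkm with h | h
        · rw [← pairing_conj hν (monicOP ν m) (monicOP ν k), ih m hm k h, map_zero, mul_zero]
        · rw [ih k k.2 m h, mul_zero]
      · intro h
        exact absurd (Finset.mem_univ _) h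
  split_ifs with h
  · subst h
    have hpos := pairing_self_pos hν (monicOP_monic ν n).ne_zero
    unfold kappa
    rw [← Complex.ofReal_pow, inv_pow, Real.sq_sqrt hpos.le, Complex.ofReal_inv, inv_inv]
    rw [pairing_self_eq hν, Complex.ofReal_re]
  · rcases lt_or_gt_of_ne h with h | h
    · rw [← pairing_conj hν, key m n h, map_zero]
    · exact key n m h

/-- The reciprocal polynomial `Φ_n^*(z) = z^n conj(Φ_n(1 / conj z))`. -/
noncomputable def recipOP (ν : ℂ → ℂ) (n : ℕ) : ℂ[X] :=
  ((monicOP ν n).map (starRingEnd ℂ)).reflect n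

/-- The Verblunsky coefficient `α_n = -conj(Φ_{n+1}(0))`. -/
noncomputable def verblunsky (ν : ℂ → ℂ) (n : ℕ) : ℂ :=
  -(starRingEnd ℂ) ((monicOP ν (n + 1)).eval 0)

/-- The associated function `G_n`. -/
noncomputable def assocG (ν : ℂ → ℂ) (n : ℕ) (z : ℂ) : ℂ :=
  1 / (2 * Real.pi * Complex.I) *
    ∮ t in C(0, 1), (monicOP ν n).eval t / (t - z) * (ν t / t ^ n)

/-- The associated function `G_n^*`; note the power `t ^ (n + 1)`. -/
noncomputable def assocGStar (ν : ℂ → ℂ) (n : ℕ) (z : ℂ) : ℂ :=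
  1 / (2 * Real.pi * Complex.I) *
    ∮ t in C(0, 1), (recipOP ν n).eval t / (t - z) * (ν t / t ^ (n + 1))

/-- The solution `Y_n`, `n ≥ 1`, of the Riemann–Hilbert problem. -/
noncomputable def Y (ν : ℂ → ℂ) (n : ℕ) (z : ℂ) : Matrix (Fin 2) (Fin 2) ℂ :=
  !![(monicOP ν n).eval z, assocG ν n z;
     -(b ν (n - 1) : ℂ) * (recipOP ν (n - 1)).eval z, -(b ν (n - 1) : ℂ) * assocGStar ν (n - 1) z]

/-- `Z` is a branch on the open set `U ⊆ ℂ ∖ (𝕋 ∪ {0})` of the multivalued matrix function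
`Z_n = Y_n C_n`, `C_n = diag(z^{-n/2} ν^{1/2}, z^{n/2} ν^{-1/2})`: here `s` and `r` are holomorphic
branches of `z^{1/2}` and `ν^{1/2}` on `U`. -/
def IsFundamentalBranch (ν : ℂ → ℂ) (n : ℕ) (U : Set ℂ)
    (Z : ℂ → Matrix (Fin 2) (Fin 2) ℂ) : Prop :=
  IsOpen U ∧ (∀ z ∈ U, ‖z‖ ≠ 1 ∧ z ≠ 0) ∧
  ∃ s r : ℂ → ℂ, DifferentiableOn ℂ s U ∧ DifferentiableOn ℂ r U ∧
    (∀ z ∈ U, s z ^ 2 = z) ∧ (∀ z ∈ U, r z ^ 2 = ν z) ∧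
    ∀ z ∈ U, Z z = Y ν n z * !![(s z ^ n)⁻¹ * r z, 0; 0, s z ^ n * (r z)⁻¹]

/-- Entrywise complex derivative of a matrix function. -/
noncomputable def matDeriv (Z : ℂ → Matrix (Fin 2) (Fin 2) ℂ) (z : ℂ) :
    Matrix (Fin 2) (Fin 2) ℂ :=
  Matrix.of fun i j => deriv (fun w => Z w i j) z

/-- `M = Z_n' Z_n⁻¹` on `ℂ ∖ (𝕋 ∪ {0})`: near each such point `Z_n` has a branch, and `M` is
the logarithmic derivative of every branch. -/
def IsStructureMatrix (ν : ℂ → ℂ) (n : ℕ) (M : ℂ → Matrix (Fin 2) (Fin 2) ℂ) : Prop :=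
  ∀ z : ℂ, ‖z‖ ≠ 1 → z ≠ 0 →
    (∃ U Z, z ∈ U ∧ IsFundamentalBranch ν n U Z) ∧
    ∀ U Z, z ∈ U → IsFundamentalBranch ν n U Z → M z = matDeriv Z z * (Z z)⁻¹

/-- The matrix function `M` has a pole of order exactly `k` at `z₀`. -/
def HasPoleOfOrder (M : ℂ → Matrix (Fin 2) (Fin 2) ℂ) (k : ℕ) (z₀ : ℂ) : Prop :=
  0 < k ∧
  (∀ i j, MeromorphicAt (fun z => M z i j) z₀ ∧
    ((-(k : ℤ) : ℤ) : WithTop ℤ) ≤ meromorphicOrderAt (fun z => M z i j) z₀) ∧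
  ∃ i j, meromorphicOrderAt (fun z => M z i j) z₀ = ((-(k : ℤ) : ℤ) : WithTop ℤ)

/-- The generalized modified Bessel weight. -/
noncomputable def besselWeight (l : ℝ) (H : ℂ → ℂ) (z : ℂ) : ℂ :=
  Complex.exp (l * (z + z⁻¹) / 2) * H z

/-- The leading coefficient at `0` of the structure matrix of the modified Bessel weight. -/
noncomputable def besselLeadingCoeff (l : ℝ) (ν : ℂ → ℂ) (n : ℕ) : Matrix (Fin 2) (Fin 2) ℂ :=
  !![(l : ℂ) / 4 * ((b ν (n - 1) : ℂ) * (b ν n : ℂ)⁻¹ - verblunsky ν (n - 1) ^ 2),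
      -((l : ℂ) / 2) * (b ν n : ℂ)⁻¹ * verblunsky ν (n - 1);
     -((l : ℂ) / 2) * (b ν (n - 1) : ℂ) * verblunsky ν (n - 1),
      -((l : ℂ) / 4) * ((b ν (n - 1) : ℂ) * (b ν n : ℂ)⁻¹ - verblunsky ν (n - 1) ^ 2)]

end OPUC

namespace OPUC

/-! On the circle the exponential factor of the weight is real and positive, so `H` is real there
and hence constant. Thus `ν` is zero-free off the origin and symmetric under conjugation, and the
Verblunsky coefficients are real; this is why the limit contains `α²` and not `|α|²`.

Deforming the contour in the Cauchy integrals continues `Y_n` from the disc to an entire matrix `W`.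
Outside the disc, `Y_n = W [1, -ν/z^n; 0, 1]`. Orthogonality fixes the behaviour at infinity, and
Liouville gives `det W = 1` (`exists_entire_Y`).

Put `u = z^{-n/2} ν^{1/2}`. Since `ν/z^n = u²`, a branch of `Z_n` is `W diag(u, u⁻¹)` inside the
circle and the same product times the constant matrix `[1, -1; 0, 1]` outside. A constant right
factor cancels in `Z' Z⁻¹`, so on both sides `M_n = W' W⁻¹ + (u'/u) W σ₃ W⁻¹` with `σ₃ = diag(1,
-1)` (`matDeriv_mul_inv_eq`). As `z² u'/u` is a polynomial with value `-ℓ/4` at `0`, `z² M_n` is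
entire with value `-(ℓ/4) W(0) σ₃ W(0)⁻¹` at `0`. The entries of `W(0)` are moments and values at
`0` of the orthogonal polynomials. -/

/-- An entire function which is real on the unit circle is constant. -/
theorem exists_const_of_real_on_circle {H : ℂ → ℂ} (hH : Differentiable ℂ H)
    (hr : ∀ z ∈ Metric.sphere (0 : ℂ) 1, (H z).im = 0) : ∃ c, ∀ z, H z = c := by
  -- For imaginary `a`, `exp (a * H)` has modulus one on the circle, so the maximum principle bounds
  -- it by one inside. Taking `a = ±I` forces `Im H = 0` in the disc.
  have key : ∀ a : ℂ, a.re = 0 → ∀ z ∈ Metric.ball (0 : ℂ) 1, (a * H z).re ≤ 0 := by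
    intro a ha z hz
    have hd : Differentiable ℂ fun w => Complex.exp (a * H w) := by fun_prop
    have h1 : ‖Complex.exp (a * H z)‖ ≤ 1 := by
      refine Complex.norm_le_of_forall_mem_frontier_norm_le (U := Metric.ball (0 : ℂ) 1)
        Metric.isBounded_ball hd.diffContOnCl (fun w hw => ?_) (subset_closure hz)
      rw [frontier_ball _ one_ne_zero] at hw
      rw [Complex.norm_exp]
      simp [ha, hr w hw]
    rw [Complex.norm_exp] at h1
    exact Real.exp_le_one_iff.1 h1
  have him : ∀ z ∈ Metric.ball (0 : ℂ) 1, (H z).im = (0 : ℝ) := by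
    intro z hz
    have h1 := key Complex.I (by simp) z hz
    have h2 := key (-Complex.I) (by simp) z hz
    simp at h1 h2
    linarith
  obtain ⟨c, hc⟩ := AnalyticOnNhd.eq_const_of_im_eq_const
    (fun z _ => hH.analyticAt z) him Metric.isOpen_ball
    ((convex_ball (0 : ℂ) 1).isConnected ⟨0, by simp⟩)
  refine ⟨c, fun z => ?_⟩
  have : H = fun _ => c := by
    refine AnalyticOnNhd.eq_of_eventuallyEq (z₀ := 0) (fun z _ => hH.analyticAt z)
      (fun z _ => analyticAt_const) ?_
    filter_upwards [Metric.ball_mem_nhds (0 : ℂ) one_pos] with w hw using hc w hw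
  exact congrFun this z

/-! ### Cauchy transforms over the unit circle -/

/-- The Cauchy transform of `f` over the unit circle. -/
noncomputable def circleCauchy (f : ℂ → ℂ) (z : ℂ) : ℂ :=
  1 / (2 * Real.pi * Complex.I) * ∮ t in C(0, 1), f t / (t - z)

theorem circleIntegral_eq_of_differentiableOn_annulus {f : ℂ → ℂ} {r R : ℝ} (h0 : 0 < r)
    (hle : r ≤ R) (hf : ∀ t : ℂ, r ≤ ‖t‖ → DifferentiableAt ℂ f t) :
    (∮ t in C(0, R), f t) = ∮ t in C(0, r), f t := by
  refine Complex.circleIntegral_eq_of_differentiable_on_annulus_off_countable h0 hle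
    Set.countable_empty (fun t ht => ?_) (fun t ht => ?_)
  · refine (hf t ?_).continuousAt.continuousWithinAt
    have := ht.2
    simp only [Metric.mem_ball, dist_zero_right, not_lt] at this
    exact this
  · refine hf t ?_
    have := ht.1.2
    simp only [Metric.mem_closedBall, dist_zero_right, not_le] at this
    exact this.le

/-- The Cauchy transform of a function holomorphic in `ℂ ∖ {0}` extends from the unit disc to an
entire function, and the extension jumps by `f` across the circle. -/
theorem exists_entire_circleCauchy {f : ℂ → ℂ} (hf : DifferentiableOn ℂ f {0}ᶜ) :
    ∃ P : ℂ → ℂ, Differentiable ℂ P ∧ (∀ z, ‖z‖ < 1 → circleCauchy f z = P z) ∧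
      ∀ z, 1 < ‖z‖ → circleCauchy f z = P z - f z := by
  have hfd : ∀ t : ℂ, t ≠ 0 → DifferentiableAt ℂ f t := fun t ht =>
    (hf t ht).differentiableAt (isOpen_compl_singleton.mem_nhds ht)
  -- The same transform over the circle of radius `R`: for `R > ‖z‖` it is holomorphic in `z` and
  -- independent of `R`, so these functions glue.
  set T : ℝ → ℂ → ℂ := fun R z => (2 * Real.pi * Complex.I : ℂ)⁻¹ • ∮ t in C(0, R), (t - z)⁻¹ • f t
    with hT
  have hT1 : ∀ z, circleCauchy f z = T 1 z := by
    intro z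
    simp only [hT, circleCauchy, smul_eq_mul, one_div]
    congr 1
    refine circleIntegral.integral_congr zero_le_one fun t _ => ?_
    simp only [div_eq_inv_mul]
  have hindep : ∀ (z : ℂ) (r R : ℝ), 0 < r → ‖z‖ < r → r ≤ R → T R z = T r z := by
    intro z r R hr hz hR
    simp only [hT]
    congr 1
    refine circleIntegral_eq_of_differentiableOn_annulus hr hR fun t ht => ?_
    have ht0 : t ≠ 0 := fun h => by simp [h] at ht; linarith
    have htz : t - z ≠ 0 := fun h => by rw [sub_eq_zero.1 h] at ht; linarith
    exact ((differentiableAt_id.sub_const z).inv htz).smul (hfd t ht0)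
  have hdiff : ∀ (R : ℝ) (z : ℂ), 0 < R → ‖z‖ < R → DifferentiableAt ℂ (T R) z := by
    intro R z hR hz
    lift R to NNReal using hR.le
    have hci : CircleIntegrable f 0 (R : ℝ) := by
      refine ContinuousOn.circleIntegrable hR.le fun t ht => ?_
      refine (hfd t fun h => ?_).continuousAt.continuousWithinAt
      rw [h] at ht
      simp at ht
      simp [← ht] at hR
    have h := hasFPowerSeriesOn_cauchy_integral hci (by exact_mod_cast hR)
    refine (h.differentiableOn z ?_).differentiableAt (Metric.isOpen_eball.mem_nhds ?_) <;>
    · rw [Metric.eball_coe]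
      simpa using hz
  refine ⟨fun z => T (‖z‖ + 1) z, fun z => ?_, fun z hz => ?_, fun z hz => ?_⟩
  · have hz : 0 ≤ ‖z‖ := norm_nonneg z
    refine (hdiff (‖z‖ + 2) z (by linarith) (by linarith)).congr_of_eventuallyEq ?_
    filter_upwards [continuous_norm.continuousAt.eventually (gt_mem_nhds (lt_add_one ‖z‖))]
      with w hw
    have hw' : 0 ≤ ‖w‖ := norm_nonneg w
    exact (hindep w (‖w‖ + 1) (‖z‖ + 2) (by linarith) (by linarith) (by linarith)).symm
  · rw [hT1]
    exact (hindep z 1 (‖z‖ + 1) one_pos hz (by linarith [norm_nonneg z])).symm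
  · rw [hT1]
    have hz0 : z ≠ 0 := fun h => by simp [h] at hz; linarith
    set R : ℝ := ‖z‖ + 1 with hR
    -- The divided difference has no singularity at `t = z`, so its contour can cross `z`. Splitting
    -- it afterwards isolates the residue `f z`.
    have hds : (∮ t in C(0, R), dslope f z t) = ∮ t in C(0, 1), dslope f z t := by
      refine circleIntegral_eq_of_differentiableOn_annulus one_pos (by linarith) fun t ht => ?_
      have ht0 : t ≠ 0 := fun h => by simp [h] at ht; linarith
      have := (Complex.differentiableOn_dslope (isOpen_compl_singleton.mem_nhds hz0)).2 hf
      exact (this t ht0).differentiableAt (isOpen_compl_singleton.mem_nhds ht0)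
    have hsplit : ∀ r : ℝ, 0 < r → r ≠ ‖z‖ → (∮ t in C(0, r), dslope f z t) =
        (∮ t in C(0, r), (t - z)⁻¹ • f t) - (∮ t in C(0, r), (t - z)⁻¹) * f z := by
      intro r hr hrz
      have hne : ∀ t ∈ Metric.sphere (0 : ℂ) r, t - z ≠ 0 := by
        intro t ht h
        rw [sub_eq_zero.1 h] at ht
        simp at ht
        exact hrz ht.symm
      have hc1 : ContinuousOn (fun t : ℂ => (t - z)⁻¹) (Metric.sphere 0 r) :=
        (continuousOn_id.sub continuousOn_const).inv₀ hne
      have hc2 : ContinuousOn f (Metric.sphere 0 r) := hf.continuousOn.mono fun t ht h => by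
        simp only [Set.mem_singleton_iff] at h
        rw [h] at ht
        simp at ht
        exact hr.ne ht
      have hi1 : CircleIntegrable (fun t => (t - z)⁻¹ • f t) 0 r :=
        (hc1.smul hc2).circleIntegrable hr.le
      have hi2 : CircleIntegrable (fun t => f z * (t - z)⁻¹) 0 r :=
        (continuousOn_const.mul hc1).circleIntegrable hr.le
      rw [mul_comm, ← circleIntegral.integral_const_mul, ← circleIntegral.integral_sub hi1 hi2]
      refine circleIntegral.integral_congr hr.le fun t ht => ?_
      have htz := hne t ht
      simp only [dslope_of_ne f (sub_ne_zero.1 htz), slope_def_field, smul_eq_mul]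
      field_simp
    rw [hsplit R (by linarith) (by linarith), hsplit 1 one_pos hz.ne,
      circleIntegral.integral_sub_inv_of_mem_ball (by simp [hR])] at hds
    have hzero : (∮ t in C((0 : ℂ), 1), (t - z)⁻¹) = 0 := by
      have hne : ∀ t : ℂ, ‖t‖ ≤ 1 → t - z ≠ 0 := by
        intro t ht h
        rw [sub_eq_zero.1 h] at ht
        linarith
      refine Complex.circleIntegral_eq_zero_of_differentiable_on_off_countable zero_le_one
        Set.countable_empty (fun t ht => ?_) (fun t ht => ?_)
      · exact ((continuousAt_id.sub continuousAt_const).inv₀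
          (hne t (by simpa using ht))).continuousWithinAt
      · have := ht.1
        simp at this
        exact (differentiableAt_id.sub_const z).inv (hne t this.le)
    rw [hzero] at hds
    have h2 : (2 * Real.pi * Complex.I : ℂ) ≠ 0 := Complex.two_pi_I_ne_zero
    simp only [hT, smul_eq_mul] at hds ⊢
    rw [show (∮ t in C(0, 1), (t - z)⁻¹ * f t) =
      (∮ t in C(0, R), (t - z)⁻¹ * f t) - 2 * Real.pi * Complex.I * f z by
        linear_combination -hds, mul_sub, inv_mul_cancel_left₀ h2]

theorem tendsto_circleCauchy_cocompact {f : ℂ → ℂ} (hf : ContinuousOn f (Metric.sphere 0 1)) :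
    Tendsto (circleCauchy f) (cocompact ℂ) (𝓝 0) := by
  obtain ⟨K, hK⟩ := (isCompact_sphere (0 : ℂ) 1).exists_bound_of_continuousOn hf
  have hbound : ∀ᶠ z in cocompact ℂ, ‖circleCauchy f z‖ ≤ K / (‖z‖ - 1) := by
    filter_upwards [(tendsto_norm_cocompact_atTop (E := ℂ)).eventually (eventually_gt_atTop 1)]
      with z hz
    have := circleIntegral.norm_two_pi_i_inv_smul_integral_le_of_norm_le_const
      (f := fun t => f t / (t - z)) (c := 0) (C := K / (‖z‖ - 1)) zero_le_one (fun t ht => by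
        rw [norm_div]
        have h1 : ‖z‖ - 1 ≤ ‖t - z‖ := by
          have h2 := norm_sub_norm_le z t
          rw [norm_sub_rev, mem_sphere_zero_iff_norm.1 ht] at h2
          exact h2
        exact div_le_div₀ ((norm_nonneg _).trans (hK t ht)) (hK t ht) (by linarith) h1)
    simpa [circleCauchy] using this
  refine squeeze_zero_norm' hbound ?_
  exact Tendsto.div_atTop tendsto_const_nhds
    (tendsto_atTop_add_const_right _ (-1 : ℝ) tendsto_norm_cocompact_atTop)

/-! ### Orthogonal polynomials: growth at infinity and moments -/

theorem eval_eq_eval_reflect_inv {p : ℂ[X]} {N : ℕ} (hp : p.natDegree ≤ N) {z : ℂ} (hz : z ≠ 0) :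
    p.eval z = (p.reflect N).eval z⁻¹ * z ^ N := by
  let _ := invertibleOfNonzero hz
  have := eval₂_reflect_mul_pow (RingHom.id ℂ) z N p hp
  rw [invOf_eq_inv] at this
  exact this.symm

/-- `p(z) / z ^ N` tends to the coefficient of `z ^ N` at infinity when `deg p ≤ N`. -/
theorem tendsto_eval_div_pow_cocompact {p : ℂ[X]} {N : ℕ} (hp : p.natDegree ≤ N) :
    Tendsto (fun z => p.eval z / z ^ N) (cocompact ℂ) (𝓝 (p.coeff N)) := by
  have h0 : (p.reflect N).eval 0 = p.coeff N := by
    rw [← coeff_zero_eq_eval_zero, coeff_reflect, revAt_zero]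
  rw [← h0]
  have hinv : Tendsto (fun z : ℂ => z⁻¹) (cocompact ℂ) (𝓝 0)  :=
    tendsto_zero_iff_norm_tendsto_zero.2 (by
      simp only [norm_inv]
      exact tendsto_norm_cocompact_atTop.inv_tendsto_atTop)
  refine (((p.reflect N).continuous.tendsto 0).comp hinv).congr' ?_
  filter_upwards [(tendsto_norm_cocompact_atTop (E := ℂ)).eventually (eventually_gt_atTop 0)]
    with z hz
  have hz0 : z ≠ 0 := norm_pos_iff.1 hz
  rw [Function.comp_apply, eval_eq_eval_reflect_inv hp hz0]
  field_simp

theorem X_pow_eq_monicOP_add (ν : ℂ → ℂ) (n : ℕ) :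
    X ^ n = monicOP ν n - ∑ k : Fin n, C (-(pairing ν (X ^ n) (monicOP ν k) /
      pairing ν (monicOP ν k) (monicOP ν k))) * monicOP ν k := by
  conv_rhs => rw [monicOP_eq]
  simp

/-- Gram–Schmidt writes `z^j` as `Φ_j` plus a combination of lower `Φ_k`, all orthogonal to `Φ_n`
except `Φ_n` itself. -/
theorem pairing_X_pow_monicOP {ν : ℂ → ℂ} (hν : IsPositiveWeight ν) {j n : ℕ} (hj : j ≤ n) :
    pairing ν (X ^ j) (monicOP ν n) = if j = n then (((kappa ν n) ^ 2)⁻¹ : ℂ) else 0 := by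
  rw [X_pow_eq_monicOP_add ν j, pairing_sub hν, pairing_sum hν, pairing_monicOP hν,
    Finset.sum_eq_zero, sub_zero]
  · split_ifs with h
    · rw [h]
    · rfl
  · intro k _
    rw [pairing_C_mul, pairing_monicOP hν k n, if_neg (by have := k.2; omega), mul_zero]

theorem conj_kappa_sq_inv (ν : ℂ → ℂ) (n : ℕ) :
    (starRingEnd ℂ) (((kappa ν n) ^ 2)⁻¹ : ℂ) = (((kappa ν n) ^ 2)⁻¹ : ℂ) := by
  rw [← Complex.ofReal_pow, ← Complex.ofReal_inv, Complex.conj_ofReal]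

theorem pairing_monicOP_X_pow {ν : ℂ → ℂ} (hν : IsPositiveWeight ν) {j n : ℕ} (hj : j ≤ n) :
    pairing ν (monicOP ν n) (X ^ j) = if j = n then (((kappa ν n) ^ 2)⁻¹ : ℂ) else 0 := by
  rw [← pairing_conj hν, pairing_X_pow_monicOP hν hj]
  split_ifs
  · exact conj_kappa_sq_inv ν n
  · exact map_zero _

theorem pairing_eq_sum_coeff {ν : ℂ → ℂ} (hν : IsPositiveWeight ν) {p : ℂ[X]} {N : ℕ}
    (hp : p.natDegree < N) (q : ℂ[X]) :
    pairing ν p q = ∑ i ∈ Finset.range N, p.coeff i * pairing ν (X ^ i) q := by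
  conv_lhs => rw [p.as_sum_range_C_mul_X_pow' hp]
  rw [pairing_sum hν]
  exact Finset.sum_congr rfl fun i _ => pairing_C_mul ν _ _ _

theorem recipOP_natDegree_le (ν : ℂ → ℂ) (n : ℕ) : (recipOP ν n).natDegree ≤ n := by
  refine natDegree_reflect_le.trans (max_le le_rfl ?_)
  exact natDegree_map_le.trans (monicOP_natDegree ν n).le

theorem recipOP_eval_zero (ν : ℂ → ℂ) (n : ℕ) : (recipOP ν n).eval 0 = 1 := by
  rw [← coeff_zero_eq_eval_zero, recipOP, coeff_reflect, revAt_zero, coeff_map]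
  have := (monicOP_monic ν n).coeff_natDegree
  rw [monicOP_natDegree] at this
  rw [this, map_one]

/-- `Φ_n^*(z) = z^n conj(Φ_n(z))` on the unit circle. -/
theorem recipOP_eval_of_norm_eq_one (ν : ℂ → ℂ) (n : ℕ) {z : ℂ} (hz : ‖z‖ = 1) :
    (recipOP ν n).eval z = z ^ n * (starRingEnd ℂ) ((monicOP ν n).eval z) := by
  have hz0 : z ≠ 0 := norm_pos_iff.1 (by rw [hz]; exact one_pos)
  have hinv : z⁻¹ = (starRingEnd ℂ) z := Complex.inv_eq_conj hz
  have hd : ((monicOP ν n).map (starRingEnd ℂ)).natDegree ≤ n :=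
    natDegree_map_le.trans (monicOP_natDegree ν n).le
  have h := eval_eq_eval_reflect_inv hd (inv_ne_zero hz0)
  rw [inv_inv, hinv, eval_map, eval₂_hom, ← hinv] at h
  rw [h, recipOP, mul_comm, mul_assoc, ← mul_pow, inv_mul_cancel₀ hz0, one_pow, mul_one]

/-- On the circle `Φ_n^* = z^n conj(Φ_n)`, so the pairing equals `⟨z^{n-j}, Φ_n⟩`. -/
theorem pairing_recipOP_X_pow {ν : ℂ → ℂ} (hν : IsPositiveWeight ν) {j n : ℕ} (hj : j ≤ n) :
    pairing ν (recipOP ν n) (X ^ j) = if j = 0 then (((kappa ν n) ^ 2)⁻¹ : ℂ) else 0 := by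
  have h : pairing ν (recipOP ν n) (X ^ j) = pairing ν (X ^ (n - j)) (monicOP ν n) := by
    rw [pairing_eq, pairing_eq]
    refine intervalIntegral.integral_congr fun θ _ => ?_
    have hz : ‖circleMap 0 1 θ‖ = 1 := by simp
    simp only [recipOP_eval_of_norm_eq_one ν n hz, eval_pow, eval_X, map_pow]
    have h1 : circleMap 0 1 θ * (starRingEnd ℂ) (circleMap 0 1 θ) = 1 := by
      rw [Complex.mul_conj, Complex.normSq_eq_norm_sq, hz]; simp
    have h2 : circleMap 0 1 θ ^ n * (starRingEnd ℂ) (circleMap 0 1 θ) ^ j =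
        circleMap 0 1 θ ^ (n - j) := by
      conv_lhs => rw [← Nat.sub_add_cancel hj, pow_add, mul_assoc, ← mul_pow, h1, one_pow, mul_one]
    linear_combination ((starRingEnd ℂ) (eval (circleMap 0 1 θ) (monicOP ν n)) *
      ν (circleMap 0 1 θ)) * h2
  rw [h, pairing_X_pow_monicOP hν (Nat.sub_le n j)]
  exact if_congr (by omega) rfl rfl

/-- `⟨Φ_n^*, z^{n+1}⟩ = α_n κ_n⁻²`. -/
theorem pairing_recipOP_X_pow_succ {ν : ℂ → ℂ} (hν : IsPositiveWeight ν) (n : ℕ) :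
    pairing ν (recipOP ν n) (X ^ (n + 1)) = verblunsky ν n * (((kappa ν n) ^ 2)⁻¹ : ℂ) := by
  have hcoeff : (monicOP ν (n + 1)).coeff (n + 1) = 1 := by
    have := (monicOP_monic ν (n + 1)).coeff_natDegree
    rwa [monicOP_natDegree] at this
  have hX : ∀ j ≤ n, pairing ν (X ^ j) (recipOP ν n) =
      if j = 0 then (((kappa ν n) ^ 2)⁻¹ : ℂ) else 0 := by
    intro j hj
    rw [← pairing_conj hν, pairing_recipOP_X_pow hν hj]
    split_ifs
    · exact conj_kappa_sq_inv ν n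
    · exact map_zero _
  have h0 : pairing ν (recipOP ν n) (monicOP ν (n + 1)) = 0 := by
    rw [pairing_eq_sum_coeff hν (Nat.lt_succ_of_le (recipOP_natDegree_le ν n))]
    refine Finset.sum_eq_zero fun i hi => ?_
    have := Finset.mem_range.1 hi
    rw [pairing_X_pow_monicOP hν this.le, if_neg this.ne, mul_zero]
  -- Expanding the vanishing pairing `⟨Φ_{n+1}, Φ_n^*⟩` in powers of `z` leaves only the constant
  -- term, with coefficient `Φ_{n+1}(0)`, and the leading term.
  rw [← pairing_conj hν, pairing_eq_sum_coeff hν (N := n + 2)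
    (by rw [monicOP_natDegree]; omega), Finset.sum_range_succ, hcoeff, one_mul,
    Finset.sum_eq_single_of_mem 0 (by simp), hX 0 (Nat.zero_le n), if_pos rfl] at h0
  · rw [map_add, map_mul, pairing_conj hν, conj_kappa_sq_inv, coeff_zero_eq_eval_zero] at h0
    rw [verblunsky]
    linear_combination h0
  · intro j hj hj0
    rw [hX j (Nat.lt_succ_iff.1 (Finset.mem_range.1 hj)), if_neg hj0, mul_zero]

theorem b_pos {ν : ℂ → ℂ} (hν : IsPositiveWeight ν) (n : ℕ) : 0 < b ν n :=
  mul_pos Real.two_pi_pos (pow_pos (kappa_pos hν n) 2)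

theorem b_inv_eq (ν : ℂ → ℂ) (n : ℕ) :
    (b ν n : ℂ)⁻¹ = 1 / (2 * Real.pi) * (((kappa ν n) ^ 2)⁻¹ : ℂ) := by
  rw [b]
  push_cast
  rw [mul_inv, one_div]

/-! ### Weights symmetric under conjugation -/

section ConjSymmetric

/-- The substitution `θ ↦ 2π - θ` conjugates the point on the circle and preserves the weight. -/
theorem pairing_map_conj {ν : ℂ → ℂ} (hν : IsPositiveWeight ν)
    (hs : ∀ z ∈ Metric.sphere (0 : ℂ) 1, ν ((starRingEnd ℂ) z) = ν z) (p q : ℂ[X]) :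
    pairing ν (p.map (starRingEnd ℂ)) (q.map (starRingEnd ℂ)) =
      (starRingEnd ℂ) (pairing ν p q) := by
  rw [pairing_eq, pairing_eq, ← intervalIntegral.intervalIntegral_conj]
  have hsub := intervalIntegral.integral_comp_sub_left (a := 0) (b := 2 * Real.pi)
    (fun θ : ℝ => (p.map (starRingEnd ℂ)).eval (circleMap 0 1 θ) *
      (starRingEnd ℂ) ((q.map (starRingEnd ℂ)).eval (circleMap 0 1 θ)) * ν (circleMap 0 1 θ))
    (2 * Real.pi)
  rw [sub_self, sub_zero] at hsub
  rw [← hsub]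
  refine intervalIntegral.integral_congr fun θ _ => ?_
  have hmem := circleMap_mem_sphere (0 : ℂ) zero_le_one θ
  have hc : circleMap 0 1 (2 * Real.pi - θ) = (starRingEnd ℂ) (circleMap 0 1 θ) := by
    rw [(periodic_circleMap (0 : ℂ) 1).sub_eq']
    simp [circleMap, ← Complex.exp_conj]
  have hreal : (starRingEnd ℂ) (ν (circleMap 0 1 θ)) = ν (circleMap 0 1 θ) :=
    Complex.conj_eq_iff_im.2 (hν.real _ hmem)
  simp only [hc, eval_map, eval₂_hom, map_mul, hs _ hmem, hreal]

/-- By induction, every Gram–Schmidt coefficient is real. -/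
theorem monicOP_map_conj {ν : ℂ → ℂ} (hν : IsPositiveWeight ν)
    (hs : ∀ z ∈ Metric.sphere (0 : ℂ) 1, ν ((starRingEnd ℂ) z) = ν z) (n : ℕ) :
    (monicOP ν n).map (starRingEnd ℂ) = monicOP ν n := by
  induction n using Nat.strong_induction_on with
  | _ n ih =>
    rw [monicOP_eq, Polynomial.map_sub, Polynomial.map_pow, map_X, Polynomial.map_sum]
    congr 1
    refine Finset.sum_congr rfl fun k _ => ?_
    have h1 := pairing_map_conj hν hs (X ^ n) (monicOP ν k)
    have h2 := pairing_map_conj hν hs (monicOP ν k) (monicOP ν k)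
    rw [Polynomial.map_pow, map_X, ih k k.2] at h1
    rw [ih k k.2] at h2
    rw [Polynomial.map_mul, map_C, ih k k.2, map_div₀, ← h1, ← h2]

theorem monicOP_eval_zero_eq_neg_verblunsky {ν : ℂ → ℂ} (hν : IsPositiveWeight ν)
    (hs : ∀ z ∈ Metric.sphere (0 : ℂ) 1, ν ((starRingEnd ℂ) z) = ν z) (n : ℕ) :
    (monicOP ν (n + 1)).eval 0 = -verblunsky ν n := by
  have h := congrArg (eval 0) (monicOP_map_conj hν hs (n + 1))
  rw [← map_zero (starRingEnd ℂ), eval_map, eval₂_hom, map_zero] at h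
  rw [verblunsky, h, neg_neg]

end ConjSymmetric

/-! ### Cauchy transforms of the orthogonal polynomials at `0` and at infinity -/

section Moments

variable {ν : ℂ → ℂ}

/-- Since `conj t = t⁻¹` on the circle, moments become contour integrals without conjugation. -/
theorem pairing_X_pow_eq (ν : ℂ → ℂ) (p : ℂ[X]) (k : ℕ) :
    pairing ν p (X ^ k) = 1 / Complex.I * ∮ t in C(0, 1), p.eval t * ν t / t ^ (k + 1) := by
  rw [pairing, ← circleIntegral.integral_const_mul]
  refine circleIntegral.integral_congr zero_le_one fun t ht => ?_
  have ht1 : ‖t‖ = 1 := by simpa using ht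
  have ht0 : t ≠ 0 := norm_pos_iff.1 (by rw [ht1]; exact one_pos)
  simp only [eval_pow, eval_X, map_pow, ← Complex.inv_eq_conj ht1, inv_pow]
  field_simp
  ring

theorem circleCauchy_zero (ν : ℂ → ℂ) (p : ℂ[X]) (n : ℕ) :
    circleCauchy (fun t => p.eval t * ν t / t ^ n) 0 =
      1 / (2 * Real.pi) * pairing ν p (X ^ n) := by
  have : (∮ t in C(0, 1), p.eval t * ν t / t ^ n / (t - 0)) =
      ∮ t in C(0, 1), p.eval t * ν t / t ^ (n + 1) := by
    refine circleIntegral.integral_congr zero_le_one fun t _ => ?_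
    simp only [sub_zero, pow_succ, div_div]
  rw [circleCauchy, pairing_X_pow_eq, this]
  field_simp

/-- The first `n` terms of the expansion at infinity of the Cauchy transform of `p ν / z^n`. -/
theorem pow_mul_circleCauchy (hν : ContinuousOn ν (Metric.sphere 0 1)) (p : ℂ[X]) (n : ℕ) {z : ℂ}
    (hz : ‖z‖ ≠ 1) :
    z ^ n * circleCauchy (fun t => p.eval t * ν t / t ^ n) z =
      circleCauchy (fun t => p.eval t * ν t) z -
        1 / (2 * Real.pi) * ∑ k ∈ Finset.range n, z ^ k * pairing ν p (X ^ k) := by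
  have hne : ∀ t ∈ Metric.sphere (0 : ℂ) 1, t - z ≠ 0 := by
    intro t ht h
    rw [sub_eq_zero.1 h] at ht
    exact hz (by simpa using ht)
  have hne0 : ∀ t ∈ Metric.sphere (0 : ℂ) 1, t ≠ 0 := fun t ht h => by simp [h] at ht
  have hi1 : CircleIntegrable (fun t => p.eval t * ν t / (t - z)) 0 1 :=
    ((p.continuous.continuousOn.mul hν).div (continuousOn_id.sub continuousOn_const)
      hne).circleIntegrable zero_le_one
  have hi2 : ∀ k ∈ Finset.range n,
      CircleIntegrable (fun t => z ^ k * (p.eval t * ν t / t ^ (k + 1))) 0 1 := fun k _ =>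
    (continuousOn_const.mul ((p.continuous.continuousOn.mul hν).div (continuousOn_id.pow (k + 1))
      fun t ht => pow_ne_zero _ (hne0 t ht))).circleIntegrable zero_le_one
  have hi3 : CircleIntegrable
      (fun t => ∑ k ∈ Finset.range n, z ^ k * (p.eval t * ν t / t ^ (k + 1))) 0 1 := by
    have := CircleIntegrable.sum (Finset.range n) hi2
    convert this using 1
    ext t
    simp
  -- Integrated form of the finite geometric sum `z^n / (t^n (t - z)) = 1 / (t - z) - ∑_{k<n} z^k /
  -- t^{k+1}`.
  have key : z ^ n * (∮ t in C(0, 1), p.eval t * ν t / t ^ n / (t - z)) =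
      (∮ t in C(0, 1), p.eval t * ν t / (t - z)) -
        ∑ k ∈ Finset.range n, z ^ k * ∮ t in C(0, 1), p.eval t * ν t / t ^ (k + 1) := by
    simp only [← circleIntegral.integral_const_mul]
    rw [← circleIntegral.integral_fun_sum hi2, ← circleIntegral.integral_sub hi1 hi3]
    refine circleIntegral.integral_congr zero_le_one fun t ht => ?_
    have htz := hne t ht
    have ht0 := hne0 t ht
    have hg := (Commute.all z t).geom_sum₂_mul n
    have hsum : ∑ k ∈ Finset.range n, z ^ k * (p.eval t * ν t / t ^ (k + 1)) =
        p.eval t * ν t / t ^ n * ∑ k ∈ Finset.range n, z ^ k * t ^ (n - 1 - k) := by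
      rw [Finset.mul_sum]
      refine Finset.sum_congr rfl fun k hk => ?_
      have hk' : n = (n - 1 - k) + (k + 1) := by
        have := Finset.mem_range.1 hk
        omega
      have hp : t ^ n = t ^ (n - 1 - k) * t ^ (k + 1) := by rw [← pow_add, ← hk']
      rw [hp]
      field_simp
    simp only [hsum]
    field_simp
    linear_combination -(p.eval t * ν t) * hg
  simp only [circleCauchy, pairing_X_pow_eq]
  rw [mul_left_comm, key, mul_sub, Finset.mul_sum, Finset.mul_sum]
  congr 1
  refine Finset.sum_congr rfl fun k _ => ?_
  field_simp

theorem assocG_eq_circleCauchy (ν : ℂ → ℂ) (n : ℕ) (z : ℂ) :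
    assocG ν n z = circleCauchy (fun t => (monicOP ν n).eval t * ν t / t ^ n) z := by
  simp only [assocG, circleCauchy]
  congr 2
  ext t
  ring

theorem assocGStar_eq_circleCauchy (ν : ℂ → ℂ) (n : ℕ) (z : ℂ) :
    assocGStar ν n z =
      circleCauchy (fun t => (recipOP ν n).eval t * ν t / t ^ (n + 1)) z := by
  simp only [assocGStar, circleCauchy]
  congr 2
  ext t
  ring

theorem assocG_zero (hν : IsPositiveWeight ν) (n : ℕ) : assocG ν n 0 = (b ν n : ℂ)⁻¹ := by
  rw [assocG_eq_circleCauchy, circleCauchy_zero, pairing_monicOP_X_pow hν le_rfl, if_pos rfl,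
    b_inv_eq]

theorem assocGStar_zero (hν : IsPositiveWeight ν) (n : ℕ) :
    assocGStar ν n 0 = verblunsky ν n * (b ν n : ℂ)⁻¹ := by
  rw [assocGStar_eq_circleCauchy, circleCauchy_zero, pairing_recipOP_X_pow_succ hν, b_inv_eq]
  ring

/-- All `n` moments in the expansion vanish by orthogonality, leaving a Cauchy transform that
decays. -/
theorem tendsto_pow_mul_assocG (hν : IsPositiveWeight ν) (n : ℕ) :
    Tendsto (fun z => z ^ n * assocG ν n z) (cocompact ℂ) (𝓝 0) := by
  refine (tendsto_circleCauchy_cocompact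
    ((monicOP ν n).continuous.continuousOn.mul hν.continuousOn)).congr' ?_
  filter_upwards [(tendsto_norm_cocompact_atTop (E := ℂ)).eventually (eventually_gt_atTop 1)]
    with z hz
  rw [assocG_eq_circleCauchy, pow_mul_circleCauchy hν.continuousOn _ _ hz.ne',
    Finset.sum_eq_zero, mul_zero, sub_zero]
  · rfl
  · intro k hk
    have hk := Finset.mem_range.1 hk
    rw [pairing_monicOP_X_pow hν hk.le, if_neg hk.ne, mul_zero]

/-- Of the `n + 1` moments only the zeroth survives; it supplies the constant limit. -/
theorem tendsto_pow_mul_assocGStar (hν : IsPositiveWeight ν) (n : ℕ) :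
    Tendsto (fun z => z ^ (n + 1) * assocGStar ν n z) (cocompact ℂ) (𝓝 (-(b ν n : ℂ)⁻¹)) := by
  have h := (tendsto_circleCauchy_cocompact
    ((recipOP ν n).continuous.continuousOn.mul hν.continuousOn)).sub_const (b ν n : ℂ)⁻¹
  rw [zero_sub] at h
  refine h.congr' ?_
  filter_upwards [(tendsto_norm_cocompact_atTop (E := ℂ)).eventually (eventually_gt_atTop 1)]
    with z hz
  rw [assocGStar_eq_circleCauchy, pow_mul_circleCauchy hν.continuousOn _ _ hz.ne',
    Finset.sum_eq_single_of_mem 0 (by simp), pairing_recipOP_X_pow hν (Nat.zero_le n), if_pos rfl,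
    pow_zero, one_mul, b_inv_eq]
  · rfl
  · intro k hk hk0
    rw [pairing_recipOP_X_pow hν (Nat.lt_succ_iff.1 (Finset.mem_range.1 hk)), if_neg hk0, mul_zero]

end Moments

/-! ### The entire continuation of `Y_n` and its logarithmic derivative -/

/-- The restriction of `Y_n` to the unit disc extends to an entire matrix function of determinant
one, and `Y_n` outside the disc is obtained from the extension through the jump matrix. -/
theorem exists_entire_Y {ν : ℂ → ℂ} (hν : IsPositiveWeight ν) (hd : DifferentiableOn ℂ ν {0}ᶜ)
    (m : ℕ) : ∃ A B C D : ℂ → ℂ, Differentiable ℂ A ∧ Differentiable ℂ B ∧ Differentiable ℂ C ∧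
      Differentiable ℂ D ∧ (∀ z, A z * D z - B z * C z = 1) ∧
      (∀ z, ‖z‖ < 1 → Y ν (m + 1) z = !![A z, B z; C z, D z]) ∧
      ∀ z, 1 < ‖z‖ → Y ν (m + 1) z =
        !![A z, B z - ν z / z ^ (m + 1) * A z; C z, D z - ν z / z ^ (m + 1) * C z] := by
  have hF : ∀ p : ℂ[X], DifferentiableOn ℂ (fun t => p.eval t * ν t / t ^ (m + 1)) {0}ᶜ :=
    fun p => (p.differentiable.differentiableOn.mul hd).div (differentiableOn_pow _)
      fun t ht => pow_ne_zero _ ht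
  obtain ⟨B, hB, hBin, hBout⟩ := exists_entire_circleCauchy (hF (monicOP ν (m + 1)))
  obtain ⟨D, hD, hDin, hDout⟩ := exists_entire_circleCauchy (hF (recipOP ν m))
  simp only [← assocG_eq_circleCauchy] at hBin hBout
  simp only [← assocGStar_eq_circleCauchy] at hDin hDout
  have hb : (b ν m : ℂ) ≠ 0 := by exact_mod_cast (b_pos hν m).ne'
  refine ⟨fun z => (monicOP ν (m + 1)).eval z, B, fun z => -(b ν m : ℂ) * (recipOP ν m).eval z,
    fun z => -(b ν m : ℂ) * D z, (monicOP ν (m + 1)).differentiable, hB,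
    (recipOP ν m).differentiable.const_mul _, hD.const_mul _, fun z => ?_, fun z hz => ?_,
    fun z hz => ?_⟩
  · have hdiff : Differentiable ℂ fun z => (monicOP ν (m + 1)).eval z * (-(b ν m : ℂ) * D z) -
        B z * (-(b ν m : ℂ) * (recipOP ν m).eval z) :=
      ((monicOP ν (m + 1)).differentiable.mul (hD.const_mul _)).sub
        (hB.mul ((recipOP ν m).differentiable.const_mul _))
    -- Liouville: the jump matrix has determinant one, so near infinity this function is `det Y`.
    -- Shifting a factor `z^(m+1)` between the two columns makes every factor converge.
    refine hdiff.apply_eq_of_tendsto_cocompact z ?_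
    have h1 := tendsto_eval_div_pow_cocompact (monicOP_natDegree ν (m + 1)).le
    have hcoeff : (monicOP ν (m + 1)).coeff (m + 1) = 1 := by
      have := (monicOP_monic ν (m + 1)).coeff_natDegree
      rwa [monicOP_natDegree] at this
    rw [hcoeff] at h1
    have h2 := tendsto_eval_div_pow_cocompact ((recipOP_natDegree_le ν m).trans m.le_succ)
    have hlim := (h1.mul ((tendsto_pow_mul_assocGStar hν m).const_mul (-(b ν m : ℂ)))).add
      ((tendsto_pow_mul_assocG hν (m + 1)).mul (h2.const_mul (b ν m : ℂ)))
    rw [show (1 : ℂ) * (-(b ν m : ℂ) * -(b ν m : ℂ)⁻¹) +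
      0 * ((b ν m : ℂ) * (recipOP ν m).coeff m.succ) = 1 by field_simp; ring] at hlim
    refine hlim.congr' ?_
    filter_upwards [(tendsto_norm_cocompact_atTop (E := ℂ)).eventually (eventually_gt_atTop 1)]
      with w hw
    have hw0 : w ≠ 0 := norm_pos_iff.1 (one_pos.trans hw)
    rw [hBout w hw, hDout w hw]
    simp only [Nat.succ_eq_add_one]
    field_simp
    ring
  · simp [Y, hBin z hz, hDin z hz]
  · rw [Y, hBout z hz, Nat.add_sub_cancel, hDout z hz]
    congr 1
    ext i j
    fin_cases i <;> fin_cases j <;> simp <;> ring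

/-- The logarithmic derivative of `[A, B; C, D] diag(u, u⁻¹) [1, -ε; 0, 1]`, where `AD - BC = 1`
and `u' = q u`. -/
theorem matDeriv_mul_inv_eq {Z : ℂ → Matrix (Fin 2) (Fin 2) ℂ} {A B C D u : ℂ → ℂ}
    {A' B' C' D' q z : ℂ} (ε : ℂ) (hA : HasDerivAt A A' z) (hB : HasDerivAt B B' z)
    (hC : HasDerivAt C C' z) (hD : HasDerivAt D D' z) (hu : HasDerivAt u (u z * q) z)
    (hu0 : u z ≠ 0) (hdet : A z * D z - B z * C z = 1)
    (hZ : ∀ᶠ w in 𝓝 z, Z w = !![A w * u w, B w * (u w)⁻¹ - ε * (A w * u w);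
      C w * u w, D w * (u w)⁻¹ - ε * (C w * u w)]) :
    matDeriv Z z * (Z z)⁻¹ =
      !![A' * D z - B' * C z + q * (A z * D z + B z * C z), B' * A z - A' * B z - q * (2 * A z * B z);
        C' * D z - D' * C z + q * (2 * C z * D z), D' * A z - C' * B z -
          q * (A z * D z + B z * C z)] := by
  have hui := hu.inv hu0
  have d00 : deriv (fun w => Z w 0 0) z = A' * u z + A z * (u z * q) := by
    refine HasDerivAt.deriv ((hA.mul hu).congr_of_eventuallyEq ?_)
    filter_upwards [hZ] with w hw
    simp [hw]
  have d10 : deriv (fun w => Z w 1 0) z = C' * u z + C z * (u z * q) := by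
    refine HasDerivAt.deriv ((hC.mul hu).congr_of_eventuallyEq ?_)
    filter_upwards [hZ] with w hw
    simp [hw]
  have d01 : deriv (fun w => Z w 0 1) z = B' * (u z)⁻¹ + B z * (-(u z * q) / u z ^ 2) -
      ε * (A' * u z + A z * (u z * q)) := by
    refine HasDerivAt.deriv (((hB.mul hui).sub ((hA.mul hu).const_mul ε)).congr_of_eventuallyEq ?_)
    filter_upwards [hZ] with w hw
    simp [hw]
  have d11 : deriv (fun w => Z w 1 1) z = D' * (u z)⁻¹ + D z * (-(u z * q) / u z ^ 2) -
      ε * (C' * u z + C z * (u z * q)) := by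
    refine HasDerivAt.deriv (((hD.mul hui).sub ((hC.mul hu).const_mul ε)).congr_of_eventuallyEq ?_)
    filter_upwards [hZ] with w hw
    simp [hw]
  have hZz := hZ.self_of_nhds
  have hdetZ : (Z z).det = 1 := by
    rw [hZz, Matrix.det_fin_two_of]
    field_simp
    linear_combination hdet
  have huq : -(u z * q) / u z ^ 2 = -q * (u z)⁻¹ := by field_simp
  -- The candidate `L` is verified through `Z' = L Z`, each entry holding modulo `AD - BC = 1`. The
  -- factor involving `ε` is constant and acts on the right, so `L` does not contain it.
  have hZ' : matDeriv Z z =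
      !![A' * D z - B' * C z + q * (A z * D z + B z * C z), B' * A z - A' * B z - q * (2 * A z * B z);
        C' * D z - D' * C z + q * (2 * C z * D z), D' * A z - C' * B z -
          q * (A z * D z + B z * C z)] * Z z := by
    ext i j
    rw [hZz, Matrix.mul_fin_two]
    fin_cases i <;> fin_cases j <;> simp [matDeriv, d00, d01, d10, d11, huq]
    · linear_combination -(u z * (A' + q * A z)) * hdet
    · linear_combination -((u z)⁻¹ * (B' - q * B z) - ε * u z * (A' + q * A z)) * hdet
    · linear_combination -(u z * (C' + q * C z)) * hdet
    · linear_combination -((u z)⁻¹ * (D' - q * D z) - ε * u z * (C' + q * C z)) * hdet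
  rw [hZ', Matrix.mul_nonsing_inv_cancel_right _ _ (by rw [hdetZ]; exact isUnit_one)]

/-- Dividing a holomorphic entry by `z^k` gives order at least `-k`, with equality for any entry
nonzero at `0`. -/
theorem hasPoleOfOrder_of_entire {E : ℂ → Matrix (Fin 2) (Fin 2) ℂ} {k : ℕ} (hk : 0 < k)
    (hE : ∀ i j, Differentiable ℂ fun z => E z i j) (h0 : E 0 ≠ 0) :
    HasPoleOfOrder (fun z => (z ^ k)⁻¹ • E z) k 0 := by
  have hpow : MeromorphicAt (fun z : ℂ => (z - 0) ^ (-(k : ℤ))) 0 := by fun_prop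
  have heq : ∀ i j, (fun z => ((z ^ k)⁻¹ • E z) i j) =
      fun z => (z - 0) ^ (-(k : ℤ)) * E z i j := by
    intro i j
    ext z
    simp
  have hmer : ∀ i j, MeromorphicAt (fun z => E z i j) 0 := fun i j =>
    ((hE i j).analyticAt 0).meromorphicAt
  refine ⟨hk, fun i j => ?_, ?_⟩
  · rw [heq]
    refine ⟨hpow.mul (hmer i j), ?_⟩
    have h1 : meromorphicOrderAt (fun z : ℂ => (z - 0) ^ (-(k : ℤ))) 0 = ((-(k : ℤ) : ℤ)) :=
      (meromorphicOrderAt_eq_int_iff hpow).2 ⟨1, analyticAt_const, by simp, by simp⟩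
    have h2 := meromorphicOrderAt_mul hpow (hmer i j)
    rw [h1] at h2
    refine le_of_le_of_eq ?_ h2.symm
    exact le_add_of_nonneg_right ((hE i j).analyticAt 0).meromorphicOrderAt_nonneg
  · obtain ⟨i, j, hij⟩ : ∃ i j, E 0 i j ≠ 0 := by
      by_contra! h
      exact h0 (Matrix.ext h)
    refine ⟨i, j, ?_⟩
    rw [heq]
    exact (meromorphicOrderAt_eq_int_iff (hpow.mul (hmer i j))).2
      ⟨fun z => E z i j, (hE i j).analyticAt 0, hij, by simp⟩

/-- If the lower left entry vanishes then `α = 0`, and the upper left entry reduces to a nonzero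
multiple of `b_{n-1} / b_n`. -/
theorem besselLeadingCoeff_ne_zero {l : ℝ} (hl : 0 < l) {ν : ℂ → ℂ} (hν : IsPositiveWeight ν)
    (n : ℕ) : besselLeadingCoeff l ν n ≠ 0 := by
  intro h
  have hl' : (l : ℂ) ≠ 0 := by exact_mod_cast hl.ne'
  have hb : ∀ k, (b ν k : ℂ) ≠ 0 := fun k => by exact_mod_cast (b_pos hν k).ne'
  have h00 := congrFun (congrFun h 0) 0
  have h10 := congrFun (congrFun h 1) 0
  have hα : verblunsky ν (n - 1) = 0 := by simpa [besselLeadingCoeff, hl', hb] using h10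
  simp [besselLeadingCoeff, hα, hl', hb] at h00

/-! ### The modified Bessel weight -/

theorem exists_const_of_isPositiveWeight_besselWeight {l : ℝ} {H : ℂ → ℂ}
    (hH : Differentiable ℂ H) (hν : IsPositiveWeight (besselWeight l H)) :
    ∃ c : ℂ, c ≠ 0 ∧ ∀ z, H z = c := by
  have hH0 : ∀ z ∈ Metric.sphere (0 : ℂ) 1, (H z).im = 0 := by
    intro z hz
    have hz1 : ‖z‖ = 1 := by simpa using hz
    have him := hν.real z hz
    have harg : (l * (z + z⁻¹) / 2 : ℂ) = ((l * z.re : ℝ) : ℂ) := by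
      rw [Complex.inv_eq_conj hz1, Complex.add_conj]
      push_cast
      ring
    rw [besselWeight, harg, ← Complex.ofReal_exp, Complex.im_ofReal_mul] at him
    exact (mul_eq_zero.1 him).resolve_left (Real.exp_pos _).ne'
  obtain ⟨c, hc⟩ := exists_const_of_real_on_circle hH hH0
  refine ⟨c, fun h => ?_, hc⟩
  obtain ⟨z, -, hz⟩ := hν.nontrivial
  exact hz (by rw [besselWeight, hc, h, mul_zero])

theorem besselWeight_conj_of_const {l : ℝ} {H : ℂ → ℂ} {c : ℂ} (hc : ∀ z, H z = c) :
    ∀ z ∈ Metric.sphere (0 : ℂ) 1, besselWeight l H ((starRingEnd ℂ) z) = besselWeight l H z := by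
  intro z hz
  have hz1 : ‖z‖ = 1 := by simpa using hz
  rw [besselWeight, besselWeight, hc, hc, ← Complex.inv_eq_conj hz1, inv_inv, add_comm]

/-- The factor `2` is kept apart because `ν / z^n` is `u²`: the remaining factor is `u'/u`. -/
theorem hasDerivAt_besselWeight_div_pow {l : ℝ} {H : ℂ → ℂ} {c : ℂ} (hc : ∀ z, H z = c) (n : ℕ)
    {z : ℂ} (hz : z ≠ 0) :
    HasDerivAt (fun w => besselWeight l H w / w ^ n) (besselWeight l H z / z ^ n *
      (2 * ((z ^ 2)⁻¹ * (l / 4 * (z ^ 2 - 1) - n * z / 2)))) z := by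
  simp only [besselWeight, hc]
  have h1 : HasDerivAt (fun w : ℂ => Complex.exp (l * (w + w⁻¹) / 2) * c)
      (Complex.exp (l * (z + z⁻¹) / 2) * (l * (1 + -(z ^ 2)⁻¹) / 2) * c) z :=
    ((((hasDerivAt_id z).add (hasDerivAt_inv hz)).const_mul (l : ℂ)).div_const 2).cexp.mul_const c
  refine (h1.div (hasDerivAt_pow n z) (pow_ne_zero n hz)).congr_deriv ?_
  rcases n with _ | n
  · field_simp
    simp
    ring
  · simp only [Nat.add_sub_cancel]
    push_cast
    field_simp
    ring

theorem exists_isFundamentalBranch_besselWeight {l : ℝ} {H : ℂ → ℂ} {c : ℂ} (hc0 : c ≠ 0)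
    (hc : ∀ z, H z = c) (n : ℕ) {z : ℂ} (hz1 : ‖z‖ ≠ 1) (hz : z ≠ 0) :
    ∃ U Z, z ∈ U ∧ IsFundamentalBranch (besselWeight l H) n U Z := by
  -- Rescaling by `z` puts the base point at `1` in the slit plane, so the root is holomorphic near
  -- `z` even when `z` lies on the negative axis.
  set s : ℂ → ℂ := fun w => Complex.exp (Complex.log z / 2) * Complex.exp (Complex.log (w / z) / 2)
    with hs
  set r : ℂ → ℂ := fun w => Complex.exp (l * (w + w⁻¹) / 4) * Complex.exp (Complex.log c / 2)
    with hr
  have hU0 : ∀ w : ℂ, w / z ∈ Complex.slitPlane → w ≠ 0 := by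
    rintro w hw rfl
    simp at hw
  refine ⟨{w | ‖w‖ ≠ 1} ∩ {w | w / z ∈ Complex.slitPlane},
    fun w => Y (besselWeight l H) n w * !![(s w ^ n)⁻¹ * r w, 0; 0, s w ^ n * (r w)⁻¹],
    ⟨hz1, by simp [hz]⟩, ?_, fun w hw => ⟨hw.1, hU0 w hw.2⟩, s, r, ?_, ?_, ?_, ?_, fun _ _ => rfl⟩
  · exact (isOpen_ne.preimage continuous_norm).inter
      (Complex.isOpen_slitPlane.preimage (continuous_id.div_const z))
  · intro w hw
    exact ((((differentiableAt_id.div_const z).clog hw.2).div_const 2).cexp.const_mul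
      _).differentiableWithinAt
  · intro w hw
    exact (((((differentiableAt_id.add (differentiableAt_inv (hU0 w hw.2))).const_mul
      (l : ℂ)).div_const 4).cexp).mul_const _).differentiableWithinAt
  · intro w hw
    simp only [hs, mul_pow, ← Complex.exp_nat_mul]
    rw [Nat.cast_ofNat, mul_div_cancel₀ _ two_ne_zero, mul_div_cancel₀ _ two_ne_zero,
      Complex.exp_log hz, Complex.exp_log (div_ne_zero (hU0 w hw.2) hz), mul_div_cancel₀ _ hz]
  · intro w hw
    simp only [hr, mul_pow, ← Complex.exp_nat_mul, besselWeight, hc]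
    rw [Nat.cast_ofNat, mul_div_cancel₀ _ two_ne_zero, Complex.exp_log hc0]
    congr 2
    ring

end OPUC

/-! ### The structure matrix and its leading coefficient -/

theorem mainTheorem7 (l : ℝ) (hl : 0 < l) (H : ℂ → ℂ) (hH : Differentiable ℂ H)
    (hν : OPUC.IsPositiveWeight (OPUC.besselWeight l H)) (n : ℕ) (hn : 1 ≤ n) :
    ∃ M : ℂ → Matrix (Fin 2) (Fin 2) ℂ,
      OPUC.IsStructureMatrix (OPUC.besselWeight l H) n M ∧
      (∀ i j, DifferentiableOn ℂ (fun z => M z i j) {0}ᶜ) ∧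
      OPUC.HasPoleOfOrder M 2 0 ∧
      OPUC.besselLeadingCoeff l (OPUC.besselWeight l H) n ≠ 0 ∧
      Tendsto (fun z : ℂ => z ^ 2 • M z) (𝓝[≠] 0)
        (𝓝 (OPUC.besselLeadingCoeff l (OPUC.besselWeight l H) n)) := by
  open OPUC in
  obtain ⟨m, rfl⟩ : ∃ m, n = m + 1 := ⟨n - 1, by omega⟩
  obtain ⟨c, hc0, hc⟩ := exists_const_of_isPositiveWeight_besselWeight hH hν
  have hne := besselLeadingCoeff_ne_zero hl hν (m + 1)
  set ν := besselWeight l H with hνdef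
  have hνd : DifferentiableOn ℂ ν {0}ᶜ := by
    intro z hz
    have := (hasDerivAt_besselWeight_div_pow (l := l) hc 0 hz).differentiableAt
    simp only [pow_zero, div_one] at this
    exact this.differentiableWithinAt
  have hν0 : ∀ z, ν z ≠ 0 := fun z => by
    rw [hνdef, besselWeight, hc]
    exact mul_ne_zero (Complex.exp_ne_zero _) hc0
  obtain ⟨A, B, C, D, hA, hB, hC, hD, hdet, hin, hout⟩ := exists_entire_Y hν hνd m
  -- `Q` is `z² u'/u`, and `E` below is `z² W' W⁻¹ + Q W σ₃ W⁻¹`, with `W⁻¹` the adjugate since `det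
  -- W = 1`.
  let Q : ℂ → ℂ := fun z => l / 4 * (z ^ 2 - 1) - (m + 1 : ℕ) * z / 2
  have hQ : Differentiable ℂ Q := by fun_prop
  let E : ℂ → Matrix (Fin 2) (Fin 2) ℂ := fun z =>
    !![z ^ 2 * (deriv A z * D z - deriv B z * C z) + Q z * (A z * D z + B z * C z),
        z ^ 2 * (deriv B z * A z - deriv A z * B z) - Q z * (2 * A z * B z);
      z ^ 2 * (deriv C z * D z - deriv D z * C z) + Q z * (2 * C z * D z),
        z ^ 2 * (deriv D z * A z - deriv C z * B z) - Q z * (A z * D z + B z * C z)]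
  have hE : ∀ i j, Differentiable ℂ fun z => E z i j := by
    have hA' := hA.deriv
    have hB' := hB.deriv
    have hC' := hC.deriv
    have hD' := hD.deriv
    intro i j
    fin_cases i <;> fin_cases j <;> simp only [E] <;> simp <;> fun_prop
  have hE0 : E 0 = besselLeadingCoeff l ν (m + 1) := by
    have hY0 := hin 0 (by simp)
    have hb : (b ν m : ℂ) ≠ 0 := by exact_mod_cast (b_pos hν m).ne'
    simp only [Y, Nat.add_sub_cancel] at hY0
    have hA0 : A 0 = -verblunsky ν m := by
      rw [← monicOP_eval_zero_eq_neg_verblunsky hν (besselWeight_conj_of_const hc) m]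
      exact (congrFun (congrFun hY0 0) 0).symm
    have hB0 : B 0 = (b ν (m + 1) : ℂ)⁻¹ := by
      rw [← assocG_zero hν (m + 1)]
      exact (congrFun (congrFun hY0 0) 1).symm
    have hC0 : C 0 = -(b ν m : ℂ) := by
      have := (congrFun (congrFun hY0 1) 0).symm
      rw [← mul_one (-(b ν m : ℂ)), ← recipOP_eval_zero ν m]
      exact this
    have hD0 : D 0 = -verblunsky ν m := by
      have : D 0 = -(b ν m : ℂ) * assocGStar ν m 0 := (congrFun (congrFun hY0 1) 1).symm
      rw [this, assocGStar_zero hν]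
      field_simp
    simp only [E, Q, besselLeadingCoeff, hA0, hB0, hC0, hD0, Nat.add_sub_cancel]
    ext i j
    fin_cases i <;> fin_cases j <;> simp <;> ring
  refine ⟨fun z => (z ^ 2)⁻¹ • E z, fun z hz1 hz => ⟨?_, ?_⟩, fun i j => ?_, ?_, hne, ?_⟩
  · exact exists_isFundamentalBranch_besselWeight hc0 hc (m + 1) hz1 hz
  · rintro U Z hzU ⟨hUo, hU, s, r, hs, hr, hs2, hr2, hZ⟩
    have hUz := hUo.mem_nhds hzU
    set u : ℂ → ℂ := fun w => (s w ^ (m + 1))⁻¹ * r w with hu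
    have hs0 : ∀ w ∈ U, s w ≠ 0 := fun w hw h => (hU w hw).2 (by rw [← hs2 w hw, h]; simp)
    have hr0 : ∀ w ∈ U, r w ≠ 0 := fun w hw h => hν0 w (by rw [← hr2 w hw, h]; simp)
    have hu2 : ∀ w ∈ U, u w ^ 2 = ν w / w ^ (m + 1) := by
      intro w hw
      rw [hu, ← hr2 w hw]
      nth_rw 3 [← hs2 w hw]
      have := hs0 w hw
      field_simp
      ring
    have hu0 : ∀ w ∈ U, u w ≠ 0 := fun w hw =>
      mul_ne_zero (inv_ne_zero (pow_ne_zero _ (hs0 w hw))) (hr0 w hw)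
    -- The derivative of the branch `u` comes from differentiating `u² = ν / z^(m+1)` and cancelling
    -- `2u`.
    have hud : HasDerivAt u (u z * ((z ^ 2)⁻¹ * Q z)) z := by
      have h1 : DifferentiableAt ℂ u z :=
        (((hs.differentiableAt hUz).pow (m + 1)).inv (pow_ne_zero _ (hs0 z hzU))).mul
          (hr.differentiableAt hUz)
      have h2 : HasDerivAt (fun w => u w ^ 2) _ z := h1.hasDerivAt.pow 2
      have h3 : HasDerivAt (fun w => u w ^ 2) _ z :=
        (hasDerivAt_besselWeight_div_pow (l := l) hc (m + 1) hz).congr_of_eventuallyEq (by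
          filter_upwards [hUz] with w hw using hu2 w hw)
      have h4 := h2.unique h3
      rw [← hνdef, ← hu2 z hzU] at h4
      have h5 : deriv u z = u z * ((z ^ 2)⁻¹ * Q z) := by
        refine mul_left_cancel₀ (mul_ne_zero two_ne_zero (hu0 z hzU)) ?_
        simp only [Q]
        simp at h4
        push_cast
        linear_combination h4
      rw [← h5]
      exact h1.hasDerivAt
    have huw : ∀ w, (s w ^ (m + 1))⁻¹ * r w = u w := fun _ => rfl
    have hinv : ∀ w, s w ^ (m + 1) * (r w)⁻¹ = (u w)⁻¹ := fun w => by simp [hu, mul_comm]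
    have key : ∀ ε : ℂ, (∀ᶠ w in 𝓝 z, Z w = !![A w * u w, B w * (u w)⁻¹ - ε * (A w * u w);
        C w * u w, D w * (u w)⁻¹ - ε * (C w * u w)]) →
        (z ^ 2)⁻¹ • E z = matDeriv Z z * (Z z)⁻¹ := by
      intro ε h
      rw [matDeriv_mul_inv_eq ε (hA z).hasDerivAt (hB z).hasDerivAt (hC z).hasDerivAt
        (hD z).hasDerivAt hud (hu0 z hzU) (hdet z) h]
      ext i j
      fin_cases i <;> fin_cases j <;> simp [E] <;> field_simp
    rcases lt_or_gt_of_ne hz1 with hlt | hgt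
    -- Inside the circle `ε = 0`; outside, the jump gives `ε = 1` because `(ν / w^(m+1)) u⁻¹ = u`.
    · refine key 0 ?_
      filter_upwards [hUz, continuous_norm.continuousAt.eventually (gt_mem_nhds hlt)] with w hw hw1
      rw [hZ w hw, hin w hw1, hinv, huw, Matrix.mul_fin_two]
      simp
    · refine key 1 ?_
      filter_upwards [hUz, continuous_norm.continuousAt.eventually (lt_mem_nhds hgt)] with w hw hw1
      have h0 := hu0 w hw
      rw [hZ w hw, hout w hw1, hinv, huw, Matrix.mul_fin_two, ← hu2 w hw]
      ext i j
      fin_cases i <;> fin_cases j <;> simp <;> field_simp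
  · simp only [Matrix.smul_apply, smul_eq_mul]
    exact ((differentiableOn_pow 2).inv fun z hz => pow_ne_zero 2 hz).mul (hE i j).differentiableOn
  · exact hasPoleOfOrder_of_entire two_pos hE (by rw [hE0]; exact hne)
  · have hcont : Continuous E := continuous_matrix fun i j => (hE i j).continuous
    rw [← hE0]
    refine ((hcont.tendsto 0).mono_left nhdsWithin_le_nhds).congr' ?_
    filter_upwards [self_mem_nhdsWithin] with z hz
    rw [smul_inv_smul₀ (pow_ne_zero 2 hz)]
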